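/- Let $\Omega\subset\mathbb R^n$ be open (for instance a bounded polyhedral domain), $d\in\mathbb N$, $X=H^1_0(\Omega)^d$ (the closure of $C_c^\infty(\Omega)^d$ in the $H^1$ norm), and let $(\cdot,\cdot)$, $\|\cdot\|$ be the inner product and norm of $L^2(\Omega)^d$ (and of the $L^2$ matrix fields). Let $\delta>0$, $0\le\alpha\le1$, and let $J\ge 0$, $k\ge0$ be integers. *Continuous algorithm.* For $f\in L^2(\Omega)^d$ let $Gf=\bar f\in X$ be the solution of $\delta^2(\nabla\bar f,\nabla v)+(\bar f,v)=(f,v)$ for all $v\in X$. For $\bar u\in \operatorname{Range}(G)$ let $u_j=D_{\alpha,j}\bar u\in L^2(\Omega)^d$ be defined by $[(1-\alpha)G+\alpha I]u_0=\bar u$ and $[(1-\alpha)G+\alpha I](u_j-u_{j-1})=\bar u-Gu_{j-1}$ for $j\ge1$. *Discrete algorithm.* Let $X^h\subset X$ be a finite-dimensional subspace. For $f\in L^2(\Omega)^d$ let $G^hf=\bar f^h\in X^h$ be the solution of $\delta^2(\nabla\bar f^h,\nabla v)+(\bar f^h,v)=(f,v)$ for all $v\in X^h$. For $\bar u^h\in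 X^h$ let $u^h_j=D^h_{\alpha,j}\bar u^h\in X^h$ be defined by $$\alpha\delta^2(\nabla u^h_0,\nabla v)+(u^h_0,v)=\delta^2(\nabla\bar u^h,\nabla v)+(\bar u^h,v)\quad\forall v\in X^h,$$ $$\alpha\delta^2(\nabla u^h_j,\nabla v)+(u^h_j,v)=\delta^2(\nabla\bar u^h,\nabla v)+(\bar u^h,v)+\alpha\delta^2(\nabla u^h_{j-1},\nabla v)\quad\forall v\in X^h,\ j\ge1;$$ if $\bar u^h=G^hu$, then $\delta^2(\nabla\bar u^h,\nabla v)+(\bar u^h,v)=(u,v)$ here. *Approximation property.* Let $h>0$ and $A$ be such that every $w\in H^{k+1}(\Omega)^d\cap X$ has an approximant $v\in X^h$ with $$\|w-v\|_{L^2(\Omega)}\le A\,h^{k+1}\|w\|_{H^{k+1}(\Omega)},\qquad \|w-v\|_{H^1(\Omega)}\le A\,h^{k}\|w\|_{H^{k+1}(\Omega)} .$$ **Theorem.** There is a constant $C>0$ depending only on $J$ and $A$ (not on $h$, $X^h$, $\alpha$, $\delta$ or $u$) such that the following holds. If $\Delta^ju\in L^2(\Omega)^d$ for all $0\le j\le J+1$,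 and $\Delta^ju\in H^1_0(\Omega)^d$ for all $0\le j\le J$ (homogeneous boundary data), then $$\|u-D^h_{\alpha,J}G^hu\|_{L^2(\Omega)}\le(\alpha\delta^2)^{J+1}\|\Delta^{J+1}u\|_{L^2(\Omega)}+C\left(\sqrt\alpha\,\delta h^k+h^{k+1}\right)\max_{0\le j\le J}\|D_{\alpha,j}Gu\|_{H^{k+1}(\Omega)},$$ where the norm $\|w\|_{H^{k+1}(\Omega)}$ is $+\infty$ if $w\notin H^{k+1}(\Omega)^d$. -/

import Mathlib

open MeasureTheory TopologicalSpace
open scoped ENNReal Distributions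

noncomputable section

namespace Mitlar

/-- The space `L²(Ω)^d` of square integrable `ℝ^d`-valued functions on an open set `Ω ⊆ ℝⁿ`. -/
abbrev L2 {n : ℕ} (Ω : Opens (EuclideanSpace ℝ (Fin n))) (d : ℕ) : Type :=
  Lp (EuclideanSpace ℝ (Fin d)) 2 (volume.restrict (Ω : Set (EuclideanSpace ℝ (Fin n))))

/-- The classical partial derivative `∂ᵢ ψ`. -/
def pderiv {n d : ℕ} (i : Fin n) (ψ : EuclideanSpace ℝ (Fin n) → EuclideanSpace ℝ (Fin d)) :
    EuclideanSpace ℝ (Fin n) → EuclideanSpace ℝ (Fin d) :=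
  fun x => fderiv ℝ ψ x (EuclideanSpace.single i 1)

/-- The classical derivative `∂₁^{β₁} ⋯ ∂ₙ^{βₙ} ψ` for a multi-index `β`. -/
def multiDeriv {n d : ℕ} (β : Fin n → ℕ)
    (ψ : EuclideanSpace ℝ (Fin n) → EuclideanSpace ℝ (Fin d)) :
    EuclideanSpace ℝ (Fin n) → EuclideanSpace ℝ (Fin d) :=
  (List.finRange n).foldr (fun i χ => (pderiv i)^[β i] χ) ψ

/-- `g ∈ L²(Ω)^d` is the weak derivative `D^β u` of `u ∈ L²(Ω)^d`. -/
def HasWeakDeriv {n d : ℕ} (Ω : Opens (EuclideanSpace ℝ (Fin n))) (β : Fin n → ℕ)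
    (u g : L2 Ω d) : Prop :=
  ∀ φ : 𝓓(Ω, EuclideanSpace ℝ (Fin d)),
    ∫ x in (Ω : Set (EuclideanSpace ℝ (Fin n))), inner ℝ (multiDeriv β φ x) (u x) =
      (-1) ^ (∑ i, β i) *
        ∫ x in (Ω : Set (EuclideanSpace ℝ (Fin n))), inner ℝ (φ x) (g x)

/-- `g ∈ L²(Ω)^d` is the weak Laplacian `Δu` of `u ∈ L²(Ω)^d`. -/
def HasWeakLaplacian {n d : ℕ} (Ω : Opens (EuclideanSpace ℝ (Fin n))) (u g : L2 Ω d) : Prop :=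
  ∀ φ : 𝓓(Ω, EuclideanSpace ℝ (Fin d)),
    ∫ x in (Ω : Set (EuclideanSpace ℝ (Fin n))), inner ℝ (∑ i, pderiv i (pderiv i φ) x) (u x) =
      ∫ x in (Ω : Set (EuclideanSpace ℝ (Fin n))), inner ℝ (φ x) (g x)

/-- The norm `‖D^β u‖_{L²}` of the weak derivative, equal to `∞` if `u` has no weak derivative
`D^β u` in `L²` (the infimum is over the at most one weak derivative). -/
def weakDerivENorm {n d : ℕ} (Ω : Opens (EuclideanSpace ℝ (Fin n))) (β : Fin n → ℕ)
    (u : L2 Ω d) : ℝ≥0∞ :=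
  ⨅ (g : L2 Ω d) (_ : HasWeakDeriv Ω β u g), ‖g‖ₑ

/-- The norm `‖u‖_{H^m(Ω)} = (∑_{|β| ≤ m} ‖D^β u‖²_{L²})^{1/2}`, equal to `∞` if `u ∉ H^m(Ω)^d`. -/
def sobolevENorm {n d : ℕ} (Ω : Opens (EuclideanSpace ℝ (Fin n))) (m : ℕ) (u : L2 Ω d) : ℝ≥0∞ :=
  (∑ r ∈ Finset.range (m + 1), ∑ β ∈ Finset.piAntidiag (Finset.univ : Finset (Fin n)) r,
    weakDerivENorm Ω β u ^ 2) ^ (1 / 2 : ℝ)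

/-- The Hilbert space `L²(Ω)^d × (L²(Ω)^d)ⁿ` of pairs (function, candidate gradient), with the
norm `(‖u‖² + ∑ᵢ ‖gᵢ‖²)^{1/2}`. -/
abbrev GradPair {n : ℕ} (Ω : Opens (EuclideanSpace ℝ (Fin n))) (d : ℕ) : Type :=
  WithLp 2 (L2 Ω d × PiLp 2 fun _ : Fin n => L2 Ω d)

lemma pderiv_add {n d : ℕ} {Ω : Opens (EuclideanSpace ℝ (Fin n))} (i : Fin n)
    (φ ψ : 𝓓(Ω, EuclideanSpace ℝ (Fin d))) (x : EuclideanSpace ℝ (Fin n)) :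
    pderiv i (φ + ψ : 𝓓(Ω, EuclideanSpace ℝ (Fin d))) x = pderiv i φ x + pderiv i ψ x := by
  have h1 : DifferentiableAt ℝ φ x := (φ.contDiff.differentiable (by simp)) x
  have h2 : DifferentiableAt ℝ ψ x := (ψ.contDiff.differentiable (by simp)) x
  simp only [pderiv]
  rw [FunLike.coe_add, fderiv_add h1 h2]
  rfl

lemma pderiv_smul {n d : ℕ} {Ω : Opens (EuclideanSpace ℝ (Fin n))} (i : Fin n)
    (c : ℝ) (φ : 𝓓(Ω, EuclideanSpace ℝ (Fin d))) (x : EuclideanSpace ℝ (Fin n)) :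
    pderiv i (c • φ : 𝓓(Ω, EuclideanSpace ℝ (Fin d))) x = c • pderiv i φ x := by
  have h1 : DifferentiableAt ℝ φ x := (φ.contDiff.differentiable (by simp)) x
  simp only [pderiv]
  rw [FunLike.coe_smul, fderiv_const_smul h1]
  rfl

/-- The pairs `(φ, ∇φ)` with `φ ∈ C_c^∞(Ω)^d`. -/
def testPairs {n : ℕ} (Ω : Opens (EuclideanSpace ℝ (Fin n))) (d : ℕ) :
    Submodule ℝ (GradPair Ω d) where
  carrier := {p | ∃ φ : 𝓓(Ω, EuclideanSpace ℝ (Fin d)),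
    p.fst =ᵐ[volume.restrict (Ω : Set (EuclideanSpace ℝ (Fin n)))] φ ∧
      ∀ i, p.snd i =ᵐ[volume.restrict (Ω : Set (EuclideanSpace ℝ (Fin n)))] pderiv i φ}
  add_mem' := by
    rintro p q ⟨φ, hφ, hφ'⟩ ⟨ψ, hψ, hψ'⟩
    refine ⟨φ + ψ, ?_, fun i => ?_⟩
    · filter_upwards [hφ, hψ, Lp.coeFn_add p.fst q.fst] with x h1 h2 h3
      simpa [h1, h2] using h3
    · filter_upwards [hφ' i, hψ' i, Lp.coeFn_add (p.snd i) (q.snd i)] with x h1 h2 h3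
      rw [pderiv_add, ← h1, ← h2]
      exact h3
  zero_mem' := by
    refine ⟨0, ?_, fun i => ?_⟩
    · filter_upwards [Lp.coeFn_zero (EuclideanSpace ℝ (Fin d)) 2
        (volume.restrict (Ω : Set (EuclideanSpace ℝ (Fin n))))] with x h
      simpa using h
    · filter_upwards [Lp.coeFn_zero (EuclideanSpace ℝ (Fin d)) 2
        (volume.restrict (Ω : Set (EuclideanSpace ℝ (Fin n))))] with x h
      have h0 := pderiv_smul i 0 (0 : 𝓓(Ω, EuclideanSpace ℝ (Fin d))) x
      rw [zero_smul, zero_smul] at h0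
      rw [h0]
      exact h
  smul_mem' := by
    rintro c p ⟨φ, hφ, hφ'⟩
    refine ⟨c • φ, ?_, fun i => ?_⟩
    · filter_upwards [hφ, Lp.coeFn_smul c p.fst] with x h1 h3
      simpa [h1] using h3
    · filter_upwards [hφ' i, Lp.coeFn_smul c (p.snd i)] with x h1 h3
      rw [pderiv_smul, ← h1]
      exact h3

/-- The space `X = H¹₀(Ω)^d`: the closure of `C_c^∞(Ω)^d` in the `H¹` norm. An element is recorded
as the pair `(v, ∇v)`, and the norm of `X` is the `H¹` norm. -/
def H10 {n : ℕ} (Ω : Opens (EuclideanSpace ℝ (Fin n))) (d : ℕ) : Type :=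
  (testPairs Ω d).topologicalClosure

instance {n : ℕ} (Ω : Opens (EuclideanSpace ℝ (Fin n))) (d : ℕ) :
    NormedAddCommGroup (H10 Ω d) :=
  inferInstanceAs (NormedAddCommGroup (testPairs Ω d).topologicalClosure)

instance {n : ℕ} (Ω : Opens (EuclideanSpace ℝ (Fin n))) (d : ℕ) :
    InnerProductSpace ℝ (H10 Ω d) :=
  inferInstanceAs (InnerProductSpace ℝ (testPairs Ω d).topologicalClosure)

instance {n : ℕ} (Ω : Opens (EuclideanSpace ℝ (Fin n))) (d : ℕ) :
    CompleteSpace (H10 Ω d) :=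
  inferInstanceAs (CompleteSpace (testPairs Ω d).topologicalClosure)

/-- The inclusion `H¹₀(Ω)^d → L²(Ω)^d`, `(v, ∇v) ↦ v`. -/
def val {n d : ℕ} {Ω : Opens (EuclideanSpace ℝ (Fin n))} : H10 Ω d →L[ℝ] L2 Ω d :=
  (WithLp.fstL 2 ℝ (L2 Ω d) (PiLp 2 fun _ : Fin n => L2 Ω d)) ∘L
    (testPairs Ω d).topologicalClosure.subtypeL

/-- The gradient `(v, ∇v) ↦ ∇v` on `H¹₀(Ω)^d`. -/
def grad {n d : ℕ} {Ω : Opens (EuclideanSpace ℝ (Fin n))} :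
    H10 Ω d →L[ℝ] PiLp 2 fun _ : Fin n => L2 Ω d :=
  (WithLp.sndL 2 ℝ (L2 Ω d) (PiLp 2 fun _ : Fin n => L2 Ω d)) ∘L
    (testPairs Ω d).topologicalClosure.subtypeL

/-- `w` solves in the subspace `V ⊆ X` the problem `a (∇w, ∇v) + (w, v) = ℓ(v)` for all `v ∈ V`. -/
def IsGalerkinSol {n d : ℕ} {Ω : Opens (EuclideanSpace ℝ (Fin n))} (V : Submodule ℝ (H10 Ω d))
    (a : ℝ) (ℓ : H10 Ω d → ℝ) (w : H10 Ω d) : Prop :=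
  w ∈ V ∧ ∀ v ∈ V, a * inner ℝ (grad w) (grad v) + inner ℝ (val w) (val v) = ℓ v

/-- The solution of the variational problem `a (∇w, ∇v) + (w, v) = ℓ(v)`, `v ∈ V`, in `V`. -/
def galerkin {n d : ℕ} {Ω : Opens (EuclideanSpace ℝ (Fin n))} (V : Submodule ℝ (H10 Ω d))
    (a : ℝ) (ℓ : H10 Ω d → ℝ) : H10 Ω d :=
  Classical.epsilon (IsGalerkinSol V a ℓ)

/-- The differential filter `G`, `Gf = f̄ ∈ X` with `δ² (∇f̄, ∇v) + (f̄, v) = (f, v)` for `v ∈ X`. -/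
def diffFilter {n d : ℕ} {Ω : Opens (EuclideanSpace ℝ (Fin n))} (δ : ℝ) (f : L2 Ω d) : H10 Ω d :=
  galerkin ⊤ (δ ^ 2) fun v => inner ℝ f (val v)

/-- The discrete differential filter `G^h`, with values in `X^h`. -/
def discFilter {n d : ℕ} {Ω : Opens (EuclideanSpace ℝ (Fin n))} (Xh : Submodule ℝ (H10 Ω d))
    (δ : ℝ) (f : L2 Ω d) : H10 Ω d :=
  galerkin Xh (δ ^ 2) fun v => inner ℝ f (val v)

/-- The operator `D_α = [(1 - α) G + α I]⁻¹` on `L²(Ω)^d`. -/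
def deconv {n d : ℕ} {Ω : Opens (EuclideanSpace ℝ (Fin n))} (α δ : ℝ) (f : L2 Ω d) : L2 Ω d :=
  Classical.epsilon fun w => (1 - α) • val (diffFilter δ w) + α • w = f

/-- The iterates `u_j = D_{α,j} ū` of the continuous algorithm:
`[(1 - α) G + α I] u₀ = ū` and `[(1 - α) G + α I] (u_{j+1} - u_j) = ū - G u_j`. -/
def mitlar {n d : ℕ} {Ω : Opens (EuclideanSpace ℝ (Fin n))} (α δ : ℝ) (ubar : L2 Ω d) :
    ℕ → L2 Ω d
  | 0 => deconv α δ ubar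
  | j + 1 => mitlar α δ ubar j + deconv α δ (ubar - val (diffFilter δ (mitlar α δ ubar j)))

/-- The iterates `u_j^h = D^h_{α,j} ū^h ∈ X^h` of the discrete algorithm for data `ū^h`: for all
`v ∈ X^h`,
`αδ² (∇u₀^h, ∇v) + (u₀^h, v) = δ² (∇ū^h, ∇v) + (ū^h, v)` and
`αδ² (∇u_{j+1}^h, ∇v) + (u_{j+1}^h, v) = δ² (∇ū^h, ∇v) + (ū^h, v) + αδ² (∇u_j^h, ∇v)`.
If `ū^h = G^h u`, then `δ² (∇ū^h, ∇v) + (ū^h, v)` is `(u, v)`. -/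
def discMitlar {n d : ℕ} {Ω : Opens (EuclideanSpace ℝ (Fin n))} (Xh : Submodule ℝ (H10 Ω d))
    (α δ : ℝ) (ubar : H10 Ω d) : ℕ → H10 Ω d
  | 0 => galerkin Xh (α * δ ^ 2) fun v =>
      δ ^ 2 * inner ℝ (grad ubar) (grad v) + inner ℝ (val ubar) (val v)
  | j + 1 => galerkin Xh (α * δ ^ 2) fun v =>
      δ ^ 2 * inner ℝ (grad ubar) (grad v) + inner ℝ (val ubar) (val v) +
        α * δ ^ 2 * inner ℝ (grad (discMitlar Xh α δ ubar j)) (grad v)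

/-- The variational problems are well posed for `a > 0`, in `X` and in its complete (for example
finite-dimensional) subspaces. -/
lemma existsUnique_isGalerkinSol {n d : ℕ} {Ω : Opens (EuclideanSpace ℝ (Fin n))}
    (V : Submodule ℝ (H10 Ω d)) [CompleteSpace V] {a : ℝ} (ha : 0 < a) (ℓ : H10 Ω d →L[ℝ] ℝ) :
    ∃! w, IsGalerkinSol V a ℓ w := by
  let gL : V →L[ℝ] PiLp 2 fun _ : Fin n => L2 Ω d := grad ∘L V.subtypeL
  let vL : V →L[ℝ] L2 Ω d := val ∘L V.subtypeL
  let B : V →L[ℝ] V →L[ℝ] ℝ :=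
    a • (innerSL ℝ).bilinearComp gL gL + (innerSL ℝ).bilinearComp vL vL
  have hB : ∀ w v : V, B w v = a * inner ℝ (grad (w : H10 Ω d)) (grad (v : H10 Ω d)) +
      inner ℝ (val (w : H10 Ω d)) (val (v : H10 Ω d)) := fun w v => rfl
  have hc : IsCoercive B := by
    refine ⟨min a 1, lt_min ha one_pos, fun w => ?_⟩
    have hn : ‖w‖ * ‖w‖ = ‖val (w : H10 Ω d)‖ * ‖val (w : H10 Ω d)‖ +
        ‖grad (w : H10 Ω d)‖ * ‖grad (w : H10 Ω d)‖ := by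
      simp only [← real_inner_self_eq_norm_mul_norm]
      exact WithLp.prod_inner_apply (𝕜 := ℝ) _ _
    rw [hB, real_inner_self_eq_norm_mul_norm, real_inner_self_eq_norm_mul_norm, mul_assoc, hn]
    have h1 := mul_self_nonneg ‖val (w : H10 Ω d)‖
    have h2 := mul_self_nonneg ‖grad (w : H10 Ω d)‖
    have h3 := min_le_left a 1
    have h4 := min_le_right a 1
    nlinarith
  let f : V := (InnerProductSpace.toDual ℝ V).symm (ℓ ∘L V.subtypeL)
  have hf : ∀ v : V, inner ℝ f v = ℓ v := fun v => by
    simp [f, InnerProductSpace.toDual_symm_apply]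
  let w := hc.continuousLinearEquivOfBilin.symm f
  have hw : ∀ v, B w v = inner ℝ f v := fun v => by
    rw [← hc.continuousLinearEquivOfBilin_apply, ContinuousLinearEquiv.apply_symm_apply]
  refine ⟨w, ⟨w.2, fun v hv => ?_⟩, ?_⟩
  · rw [← hf ⟨v, hv⟩, ← hw]
    rfl
  · rintro w' ⟨hw'V, hw'⟩
    have h1 : f = hc.continuousLinearEquivOfBilin ⟨w', hw'V⟩ := by
      refine hc.unique_continuousLinearEquivOfBilin fun v => ?_
      rw [hf, hB]
      exact (hw' v v.2).symm
    have h2 : w = ⟨w', hw'V⟩ := by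
      simp only [w, h1, ContinuousLinearEquiv.symm_apply_apply]
    rw [h2]

lemma isGalerkinSol_diffFilter {n d : ℕ} {Ω : Opens (EuclideanSpace ℝ (Fin n))} {δ : ℝ}
    (hδ : 0 < δ) (f : L2 Ω d) :
    IsGalerkinSol ⊤ (δ ^ 2) (fun v => inner ℝ f (val v)) (diffFilter δ f) := by
  have : CompleteSpace (⊤ : Submodule ℝ (H10 Ω d)) :=
    (isClosed_univ (X := H10 Ω d)).completeSpace_coe
  exact Classical.epsilon_spec (existsUnique_isGalerkinSol ⊤ (pow_pos hδ 2)
    ((innerSL ℝ f) ∘L val)).exists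

/-- For `α > 0` the operator `(1 - α) G + α I` is a bijection of `L²(Ω)^d`. (For `α = 0` it is `G`,
which is injective, and the algorithm only inverts it on the range of `G`.) -/
lemma existsUnique_deconv {n d : ℕ} {Ω : Opens (EuclideanSpace ℝ (Fin n))} {α δ : ℝ}
    (hα : 0 < α) (hδ : 0 < δ) (f : L2 Ω d) :
    ∃! w, (1 - α) • val (diffFilter δ w) + α • w = f := by
  have : CompleteSpace (⊤ : Submodule ℝ (H10 Ω d)) :=
    (isClosed_univ (X := H10 Ω d)).completeSpace_coe
  let l (f : L2 Ω d) : H10 Ω d →L[ℝ] ℝ := (innerSL ℝ f) ∘L val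
  obtain ⟨p, ⟨-, hp⟩, hpu⟩ :=
    existsUnique_isGalerkinSol ⊤ (mul_pos hα (pow_pos hδ 2)) (l f)
  have hl : ∀ f v, l f v = inner ℝ f (val v) := fun _ _ => rfl
  have hα' := hα.ne'
  refine ⟨α⁻¹ • (f - (1 - α) • val p), ?_, fun w hw => ?_⟩
  · set w := α⁻¹ • (f - (1 - α) • val p) with hw
    have hG : diffFilter δ w = p := by
      refine (existsUnique_isGalerkinSol ⊤ (pow_pos hδ 2) (l w)).unique
        (isGalerkinSol_diffFilter hδ w) ⟨trivial, fun v _ => ?_⟩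
      have := hp v trivial
      rw [hl] at this ⊢
      rw [hw, inner_smul_left, inner_sub_left, inner_smul_left, ← this]
      simp only [conj_trivial]
      field_simp
      ring
    show (1 - α) • val (diffFilter δ w) + α • w = f
    rw [hG, hw, smul_inv_smul₀ hα']
    abel
  · have hs := isGalerkinSol_diffFilter hδ w
    have hG : diffFilter δ w = p := by
      refine hpu _ ⟨trivial, fun v _ => ?_⟩
      have := hs.2 v trivial
      simp only at this
      rw [hl, ← hw, inner_add_left, inner_smul_left, inner_smul_left, ← this]
      simp only [conj_trivial]
      ring
    rw [← hG, ← hw, add_sub_cancel_left, inv_smul_smul₀ hα']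

/-- `X^h` has the approximation property of order `k` at mesh size `h` with constant `A`: every
`w ∈ H^{k+1}(Ω)^d ∩ H¹₀(Ω)^d` has an approximant `v ∈ X^h` with
`‖w - v‖_{L²} ≤ A h^{k+1} ‖w‖_{H^{k+1}}` and `‖w - v‖_{H¹} ≤ A h^k ‖w‖_{H^{k+1}}`. -/
def HasApproxProperty {n d : ℕ} {Ω : Opens (EuclideanSpace ℝ (Fin n))}
    (Xh : Submodule ℝ (H10 Ω d)) (k : ℕ) (h A : ℝ) : Prop :=
  ∀ w : H10 Ω d, sobolevENorm Ω (k + 1) (val w) ≠ ∞ →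
    ∃ v ∈ Xh, ‖val (w - v)‖ ≤ A * h ^ (k + 1) * (sobolevENorm Ω (k + 1) (val w)).toReal ∧
      ‖w - v‖ ≤ A * h ^ k * (sobolevENorm Ω (k + 1) (val w)).toReal

/-- `z j = Δ^j u` for `0 ≤ j ≤ m`, with all these functions in `L²(Ω)^d`, and those with `j < m`
have homogeneous boundary data, i.e. belong to `H¹₀(Ω)^d`. -/
def IsLaplacianPowers {n d : ℕ} {Ω : Opens (EuclideanSpace ℝ (Fin n))} (u : L2 Ω d) (m : ℕ)
    (z : ℕ → L2 Ω d) : Prop :=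
  z 0 = u ∧ ∀ j < m, (∃ v : H10 Ω d, val v = z j) ∧ HasWeakLaplacian Ω (z j) (z (j + 1))

end Mitlar

end

noncomputable section

namespace Mitlar

/-! Put a = αδ². On data in the range of G the continuous algorithm is governed by the resolvent T =
(1 - aΔ)⁻¹: one has D_α G f = T f (`deconv_val_diffFilter`), hence u_{j+1} - u_j = T(u - u_j) and u
- u_J = (1 - T)^{J+1} u. The boundary conditions on Δ^j u give T(Δ^j u - a Δ^{j+1} u) = Δ^j u, so (1
- T) Δ^j u = -a T Δ^{j+1} u. Since T is a contraction commuting with 1 - T, the continuous error is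
at most a^{J+1} ‖Δ^{J+1} u‖ (`norm_sub_val_le`).

The discrete iterates solve the same variational problems, tested only in X^h. Subtracting, e_j =
u_j - u_j^h satisfies a(∇e_j, ∇v) + (e_j, v) = a(∇e_{j-1}, ∇v) on X^h. In the energy norm (a‖∇·‖² +
‖·‖²)^{1/2} each step adds at most twice the approximation error of u_j and does not amplify e_{j-1}
(`norm_energyMap_error_le`). Summing J + 1 steps bounds u_J - u_J^h, and the triangle inequality
concludes. All arguments include the degenerate case a = 0. -/

variable {n d : ℕ} {Ω : Opens (EuclideanSpace ℝ (Fin n))}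

/-! ### Test functions, Green's formula and density. -/

/-- The partial derivative of a test function, as a test function. -/
def testPderiv (i : Fin n) (φ : 𝓓(Ω, EuclideanSpace ℝ (Fin d))) :
    𝓓(Ω, EuclideanSpace ℝ (Fin d)) where
  toFun := pderiv i φ
  contDiff' := by
    have h : ContDiff ℝ (⊤ : ℕ∞) (fderiv ℝ φ) := φ.contDiff.fderiv_right (by simp)
    exact h.clm_apply contDiff_const
  hasCompactSupport' := φ.hasCompactSupport.fderiv_apply ℝ _
  tsupport_subset' := (tsupport_fderiv_apply_subset ℝ _).trans φ.tsupport_subset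

lemma memLp_test (φ : 𝓓(Ω, EuclideanSpace ℝ (Fin d))) :
    MemLp φ 2 (volume.restrict (Ω : Set (EuclideanSpace ℝ (Fin n)))) :=
  φ.continuous.memLp_of_hasCompactSupport φ.hasCompactSupport

/-- The class in `L²(Ω)^d` of a test function. -/
def testLp (φ : 𝓓(Ω, EuclideanSpace ℝ (Fin d))) : L2 Ω d := (memLp_test φ).toLp φ

lemma coeFn_testLp (φ : 𝓓(Ω, EuclideanSpace ℝ (Fin d))) :
    testLp φ =ᵐ[volume.restrict (Ω : Set (EuclideanSpace ℝ (Fin n)))] φ :=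
  (memLp_test φ).coeFn_toLp

lemma inner_testLp_left (φ : 𝓓(Ω, EuclideanSpace ℝ (Fin d))) (g : L2 Ω d) :
    inner ℝ (testLp φ) g =
      ∫ x in (Ω : Set (EuclideanSpace ℝ (Fin n))), inner ℝ (φ x) (g x) := by
  rw [L2.inner_def]
  refine integral_congr_ae ?_
  filter_upwards [coeFn_testLp φ] with x hx
  rw [hx]

/-- Extension by zero to all of ℝⁿ, where integration by parts has no boundary term. -/
lemma inner_testLp_testLp (φ ψ : 𝓓(Ω, EuclideanSpace ℝ (Fin d))) :
    inner ℝ (testLp φ) (testLp ψ) = ∫ x, inner ℝ (φ x) (ψ x) := by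
  have h0 : ∀ x ∉ (Ω : Set (EuclideanSpace ℝ (Fin n))), inner ℝ (φ x) (ψ x) = 0 := fun x hx => by
    rw [image_eq_zero_of_notMem_tsupport fun h => hx (φ.tsupport_subset h), inner_zero_left]
  rw [inner_testLp_left, ← setIntegral_eq_integral_of_forall_compl_eq_zero h0]
  refine integral_congr_ae ?_
  filter_upwards [coeFn_testLp ψ] with x hx
  rw [hx]

lemma integrable_inner_test (φ ψ : 𝓓(Ω, EuclideanSpace ℝ (Fin d))) :
    Integrable fun x => inner ℝ (φ x) (ψ x) := by
  refine (φ.continuous.inner ψ.continuous).integrable_of_hasCompactSupport ?_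
  refine φ.hasCompactSupport.mono fun x hx h => hx ?_
  simp only [h, inner_zero_left]

/-- Integration by parts for test functions. -/
lemma inner_testLp_testPderiv (i : Fin n) (φ ψ : 𝓓(Ω, EuclideanSpace ℝ (Fin d))) :
    inner ℝ (testLp ψ) (testLp (testPderiv i φ)) =
      -inner ℝ (testLp (testPderiv i ψ)) (testLp φ) := by
  rw [inner_testLp_testLp, inner_testLp_testLp]
  exact integral_bilinear_fderiv_right_eq_neg_left_of_integrable (B := innerSL ℝ)
    (integrable_inner_test (testPderiv i ψ) φ) (integrable_inner_test ψ (testPderiv i φ))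
    (integrable_inner_test ψ φ) (fun x _ => (ψ.contDiff.differentiable (by simp)) x)
    (fun x _ => (φ.contDiff.differentiable (by simp)) x)

/-- A test function as an element of `H¹₀(Ω)^d`. -/
def ofTest (φ : 𝓓(Ω, EuclideanSpace ℝ (Fin d))) : H10 Ω d :=
  ⟨WithLp.toLp 2 (testLp φ, WithLp.toLp 2 fun i => testLp (testPderiv i φ)),
    (testPairs Ω d).le_topologicalClosure
      ⟨φ, coeFn_testLp φ, fun i => coeFn_testLp (testPderiv i φ)⟩⟩

lemma val_ofTest (φ : 𝓓(Ω, EuclideanSpace ℝ (Fin d))) : val (ofTest φ) = testLp φ := rfl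

lemma grad_ofTest (φ : 𝓓(Ω, EuclideanSpace ℝ (Fin d))) (i : Fin n) :
    grad (ofTest φ) i = testLp (testPderiv i φ) := rfl

/-- Allows identities continuous in the H¹ norm to be checked on test functions only. -/
lemma denseRange_ofTest : DenseRange (ofTest : 𝓓(Ω, EuclideanSpace ℝ (Fin d)) → H10 Ω d) := by
  intro p
  have h : p ∈ closure ((Subtype.val : (testPairs Ω d).topologicalClosure → GradPair Ω d) ⁻¹'
      (testPairs Ω d)) := by
    have hs : (Subtype.val : (testPairs Ω d).topologicalClosure → GradPair Ω d) ''
        (Subtype.val ⁻¹' (testPairs Ω d : Set (GradPair Ω d))) = testPairs Ω d :=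
      Subtype.image_preimage_coe _ _ |>.trans
        (Set.inter_eq_right.2 (testPairs Ω d).le_topologicalClosure)
    refine closure_subtype.2 ?_
    erw [hs]
    exact p.2
  refine closure_mono ?_ h
  rintro q ⟨φ, h1, h2⟩
  refine ⟨φ, Subtype.ext ?_⟩
  refine (WithLp.ofLp_injective 2) (Prod.ext ?_ ?_)
  · exact Lp.ext ((coeFn_testLp φ).trans h1.symm)
  · refine (WithLp.ofLp_injective 2) (funext fun i => ?_)
    exact Lp.ext ((coeFn_testLp (testPderiv i φ)).trans (h2 i).symm)

/-- Green's formula `(∇p, ∇φ) = -(p, Δφ)` for `p ∈ H¹₀(Ω)^d` and a test function `φ`. -/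
lemma inner_grad_grad_ofTest (p : H10 Ω d) (φ : 𝓓(Ω, EuclideanSpace ℝ (Fin d))) :
    inner ℝ (grad p) (grad (ofTest φ)) =
      -inner ℝ (val p) (∑ i, testLp (testPderiv i (testPderiv i φ))) := by
  induction p using denseRange_ofTest.induction_on with
  | hp =>
    refine isClosed_eq ?_ ?_
    · exact grad.continuous.inner continuous_const
    · exact (val.continuous.inner continuous_const).neg
  | ih ψ =>
    rw [PiLp.inner_apply, inner_sum, ← Finset.sum_neg_distrib]
    refine Finset.sum_congr rfl fun i _ => ?_
    rw [grad_ofTest, grad_ofTest, val_ofTest, inner_testLp_testPderiv i (testPderiv i φ) ψ, neg_neg]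

lemma coeFn_sum_testLp (φ : Fin n → 𝓓(Ω, EuclideanSpace ℝ (Fin d))) :
    (∑ i, testLp (φ i) : L2 Ω d) =ᵐ[volume.restrict (Ω : Set (EuclideanSpace ℝ (Fin n)))]
      fun x => ∑ i, φ i x := by
  have h : ∀ᵐ x ∂(volume.restrict (Ω : Set (EuclideanSpace ℝ (Fin n)))),
      ∀ i, testLp (φ i) x = φ i x := ae_all_iff.2 fun i => coeFn_testLp (φ i)
  filter_upwards [h, Lp.coeFn_finsetSum Finset.univ fun i => testLp (φ i)] with x h1 h2
  rw [h2, Finset.sum_apply]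
  exact Finset.sum_congr rfl fun i _ => h1 i

lemma HasWeakLaplacian.inner_eq {u g : L2 Ω d} (h : HasWeakLaplacian Ω u g)
    (φ : 𝓓(Ω, EuclideanSpace ℝ (Fin d))) :
    inner ℝ (∑ i, testLp (testPderiv i (testPderiv i φ))) u = inner ℝ (testLp φ) g := by
  rw [inner_testLp_left, ← h φ, L2.inner_def]
  refine integral_congr_ae ?_
  filter_upwards [coeFn_sum_testLp fun i => testPderiv i (testPderiv i φ)] with x hx
  rw [hx]
  rfl

/-- If `p ∈ H¹₀(Ω)^d` has the weak Laplacian `g`, then `(∇p, ∇v) = -(g, v)` for all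
`v ∈ H¹₀(Ω)^d`. -/
lemma HasWeakLaplacian.inner_grad_grad {p : H10 Ω d} {g : L2 Ω d}
    (h : HasWeakLaplacian Ω (val p) g) (v : H10 Ω d) :
    inner ℝ (grad p) (grad v) = -inner ℝ g (val v) := by
  induction v using denseRange_ofTest.induction_on with
  | hp =>
    refine isClosed_eq ?_ ?_
    · exact continuous_const.inner grad.continuous
    · exact (continuous_const.inner val.continuous).neg
  | ih φ =>
    rw [inner_grad_grad_ofTest, real_inner_comm, h.inner_eq, real_inner_comm, val_ofTest]

/-- Test functions are dense in `L²(Ω)^d`. -/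
lemma eq_zero_of_forall_inner_testLp {w : L2 Ω d}
    (h : ∀ φ : 𝓓(Ω, EuclideanSpace ℝ (Fin d)), inner ℝ (testLp φ) w = 0) : w = 0 := by
  have hw : LocallyIntegrable w (volume.restrict (Ω : Set (EuclideanSpace ℝ (Fin n)))) :=
    (Lp.memLp w).locallyIntegrable one_le_two
  have h0 := Ω.isOpen.ae_eq_zero_of_integral_contDiff_smul_eq_zero
      (locallyIntegrableOn_of_locallyIntegrable_restrict hw) fun g hg hgc hgs => by
    have hg0 : ∀ x ∉ (Ω : Set (EuclideanSpace ℝ (Fin n))), g x • w x = 0 := fun x hx => by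
      rw [image_eq_zero_of_notMem_tsupport fun h => hx (hgs h), zero_smul]
    rw [← setIntegral_eq_integral_of_forall_compl_eq_zero hg0]
    -- Pairing with a constant vector `c` turns the scalar test function `g` into the vector-valued
    -- one `g • c`, to which `h` applies.
    refine ext_inner_left ℝ fun c => ?_
    rw [← integral_inner (hw.integrable_smul_left_of_hasCompactSupport hg.continuous hgc),
      inner_zero_right]
    let φ : 𝓓(Ω, EuclideanSpace ℝ (Fin d)) :=
      ⟨fun x => g x • c, hg.smul contDiff_const, hgc.smul_right,
        (tsupport_smul_subset_left g fun _ => c).trans hgs⟩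
    rw [← h φ, inner_testLp_left]
    refine integral_congr_ae (.of_forall fun x => ?_)
    change inner ℝ c (g x • w x) = inner ℝ (g x • c) (w x)
    rw [real_inner_smul_left, real_inner_smul_right]
  refine Lp.ext ?_
  filter_upwards [(ae_restrict_iff' Ω.isOpen.measurableSet).2 h0,
    Lp.coeFn_zero (EuclideanSpace ℝ (Fin d)) 2
        (volume.restrict (Ω : Set (EuclideanSpace ℝ (Fin n))))] with x h1 h2
  rw [h1, h2]
  rfl

/-! ### The resolvent and the continuous iterates. -/

/-- `p` is a weak solution in `H¹₀(Ω)^d` of `-a Δp + p = f`. -/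
def IsResolvent (a : ℝ) (f : L2 Ω d) (p : H10 Ω d) : Prop :=
  ∀ v, a * inner ℝ (grad p) (grad v) + inner ℝ (val p) (val v) = inner ℝ f (val v)

lemma isResolvent_diffFilter {δ : ℝ} (hδ : 0 < δ) (f : L2 Ω d) :
    IsResolvent (δ ^ 2) f (diffFilter δ f) :=
  fun v => (isGalerkinSol_diffFilter hδ f).2 v trivial

namespace IsResolvent

variable {a : ℝ} {f g : L2 Ω d} {p q : H10 Ω d}

lemma add (hp : IsResolvent a f p) (hq : IsResolvent a g q) : IsResolvent a (f + g) (p + q) :=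
  fun v => by
    rw [map_add, map_add, inner_add_left, inner_add_left, inner_add_left, ← hp v, ← hq v]
    ring

lemma smul (c : ℝ) (hp : IsResolvent a f p) : IsResolvent a (c • f) (c • p) := fun v => by
  rw [map_smul, map_smul, real_inner_smul_left, real_inner_smul_left, real_inner_smul_left, ← hp v]
  ring

lemma sub (hp : IsResolvent a f p) (hq : IsResolvent a g q) : IsResolvent a (f - g) (p - q) := by
  simpa [sub_eq_add_neg] using hp.add (hq.smul (-1))

/-- Test the equation with `p` itself and drop the gradient term. -/
lemma norm_val_le (ha : 0 ≤ a) (hp : IsResolvent a f p) : ‖val p‖ ≤ ‖f‖ := by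
  have h := hp p
  rw [real_inner_self_eq_norm_sq, real_inner_self_eq_norm_sq] at h
  have h1 := real_inner_le_norm f (val p)
  have h2 := mul_nonneg ha (sq_nonneg ‖grad p‖)
  by_contra! hlt
  nlinarith [norm_nonneg f, norm_nonneg (val p)]

lemma val_eq (ha : 0 ≤ a) (hp : IsResolvent a f p) (hq : IsResolvent a f q) : val p = val q := by
  have h := (hp.sub hq).norm_val_le ha
  rw [sub_self, norm_zero, norm_le_zero_iff, map_sub] at h
  exact sub_eq_zero.1 h

/-- The datum is determined by the `L²` class of the solution. -/
lemma datum_eq (hp : IsResolvent a f p) (hq : IsResolvent a g q) (h : val p = val q) : f = g := by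
  refine sub_eq_zero.1 (eq_zero_of_forall_inner_testLp fun φ => ?_)
  -- Green's formula moves both derivatives onto `φ`, so the gradient term depends only on `val p -
  -- val q = 0`.
  have h1 := hp.sub hq (ofTest φ)
  rw [inner_grad_grad_ofTest, map_sub, h, sub_self, inner_zero_left, inner_zero_left, neg_zero,
    mul_zero, zero_add] at h1
  rw [real_inner_comm, ← val_ofTest, ← h1]

end IsResolvent

lemma exists_isResolvent {a : ℝ} (ha : 0 < a) (f : L2 Ω d) : ∃ p, IsResolvent a f p := by
  have : CompleteSpace (⊤ : Submodule ℝ (H10 Ω d)) :=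
    (isClosed_univ (X := H10 Ω d)).completeSpace_coe
  obtain ⟨p, hp, -⟩ := existsUnique_isGalerkinSol ⊤ ha ((innerSL ℝ f) ∘L val)
  exact ⟨p, fun v => hp.2 v trivial⟩

lemma isResolvent_zero (p : H10 Ω d) : IsResolvent 0 (val p) p := fun v => by
  rw [zero_mul, zero_add]

/-- The resolvent `(1 - aΔ)⁻¹` is a linear contraction of `L²(Ω)^d`. -/
lemma exists_linearMap_resolvent {a : ℝ} (ha : 0 ≤ a) :
    ∃ T : L2 Ω d →ₗ[ℝ] L2 Ω d, (∀ f, ‖T f‖ ≤ ‖f‖) ∧ ∀ f p, IsResolvent a f p → T f = val p := by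
  -- For `a = 0` the problem is solvable only for data in H¹₀; the identity is the extension to all
  -- of L².
  rcases ha.eq_or_lt with rfl | ha'
  · exact ⟨LinearMap.id, fun f => le_rfl, fun f p hp => hp.datum_eq (isResolvent_zero p) rfl⟩
  · choose R hR using exists_isResolvent (Ω := Ω) (d := d) ha'
    refine ⟨⟨⟨fun f => val (R f), fun f g => ?_⟩, fun c f => ?_⟩, fun f => (hR f).norm_val_le ha,
      fun f p hp => (hR f).val_eq ha hp⟩
    · rw [← map_add]
      exact (hR _).val_eq ha ((hR f).add (hR g))
    · simp only [RingHom.id_apply]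
      rw [← map_smul]
      exact (hR _).val_eq ha ((hR f).smul c)

/-- Applying the form δ²(∇·, ∇v) + (·, v) to (1 - α)Gp + αp gives αδ²(∇p, ∇v) + (p, v) = (f, v).
Thus (1 - α)Gp + αp and Gf solve the same problem and coincide. -/
lemma deconv_val_diffFilter {α δ : ℝ} (hα : 0 ≤ α) (hδ : 0 < δ) {f : L2 Ω d} {p : H10 Ω d}
    (hp : IsResolvent (α * δ ^ 2) f p) : deconv α δ (val (diffFilter δ f)) = val p := by
  have hex : (1 - α) • val (diffFilter δ (val p)) + α • val p = val (diffFilter δ f) := by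
    rw [← map_smul, ← map_smul, ← map_add]
    refine IsResolvent.val_eq (sq_nonneg δ) (fun v => ?_) (isResolvent_diffFilter hδ f)
    have h := isResolvent_diffFilter hδ (val p) v
    rw [← hp v, map_add, map_add, map_smul, map_smul, map_smul, map_smul]
    simp only [inner_add_left, real_inner_smul_left]
    linear_combination (1 - α) * h
  have hde : (1 - α) • val (diffFilter δ (deconv α δ (val (diffFilter δ f)))) +
      α • deconv α δ (val (diffFilter δ f)) = val (diffFilter δ f) :=
    Classical.epsilon_spec (p := fun w => (1 - α) • val (diffFilter δ w) + α • w =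
      val (diffFilter δ f)) ⟨_, hex⟩
  -- For `α = 0` the operator to invert is G, which is injective by `datum_eq`.
  rcases hα.eq_or_lt with rfl | hα'
  · simp only [sub_zero, one_smul, zero_smul, add_zero] at hde hex
    exact (isResolvent_diffFilter hδ _).datum_eq (isResolvent_diffFilter hδ _) (hde.trans hex.symm)
  · exact (existsUnique_deconv hα' hδ _).unique hde hex

lemma val_diffFilter_sub {δ : ℝ} (hδ : 0 < δ) (f g : L2 Ω d) :
    val (diffFilter δ f) - val (diffFilter δ g) = val (diffFilter δ (f - g)) := by
  rw [← map_sub]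
  exact ((isResolvent_diffFilter hδ f).sub (isResolvent_diffFilter hδ g)).val_eq (sq_nonneg δ)
    (isResolvent_diffFilter hδ _)

/-- The iterates of the continuous algorithm belong to `H¹₀(Ω)^d` and solve variational problems. -/
lemma exists_mitlar_eq_val {α δ : ℝ} (hα : 0 ≤ α) (hδ : 0 < δ) (w : H10 Ω d) :
    ∃ U : ℕ → H10 Ω d,
      (∀ j, mitlar α δ (val (diffFilter δ (val w))) j = val (U j)) ∧
      IsResolvent (α * δ ^ 2) (val w) (U 0) ∧
      ∀ j, IsResolvent (α * δ ^ 2) (val w - val (U j)) (U (j + 1) - U j) := by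
  have hR : ∀ p : H10 Ω d, ∃ q, IsResolvent (α * δ ^ 2) (val p) q := fun p => by
    rcases hα.eq_or_lt with rfl | hα'
    -- For a zero coefficient the solution is the datum itself, which must therefore lie in H¹₀.
    · exact ⟨p, by simpa using isResolvent_zero p⟩
    · exact exists_isResolvent (by positivity) _
  choose R hR using hR
  let U : ℕ → H10 Ω d := fun j => Nat.rec (R w) (fun _ p => p + R (w - p)) j
  have hU : ∀ j, U (j + 1) = U j + R (w - U j) := fun _ => rfl
  have hstep : ∀ j, IsResolvent (α * δ ^ 2) (val w - val (U j)) (U (j + 1) - U j) := fun j => by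
    rw [hU, add_sub_cancel_left, ← map_sub]
    exact hR _
  refine ⟨U, fun j => ?_, hR w, hstep⟩
  induction j with
  | zero => exact deconv_val_diffFilter hα hδ (hR w)
  | succ j ih =>
    rw [mitlar, ih, val_diffFilter_sub hδ, deconv_val_diffFilter hα hδ (hstep j), map_sub]
    abel

/-! ### Error of the continuous algorithm. -/

/-- If `z j - a z (j + 1)` is mapped to `z j` by a linear contraction `T`, then
`(1 - T)^m z 0` is bounded by `a^m z m`. -/
lemma norm_one_sub_pow_apply_le {H : Type*} [NormedAddCommGroup H] [NormedSpace ℝ H]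
    (T : Module.End ℝ H) (hT : ∀ x, ‖T x‖ ≤ ‖x‖) {a : ℝ} (ha : 0 ≤ a) (m : ℕ) (z : ℕ → H)
    (hz : ∀ j < m, T (z j - a • z (j + 1)) = z j) :
    ‖((1 - T) ^ m) (z 0)‖ ≤ a ^ m * ‖z m‖ := by
  induction m generalizing z with
  | zero => simp
  | succ m ih =>
    -- One factor 1 - T is traded for a factor `a` and a shift of the sequence; the remaining
    -- factors commute past `T`, so induction applies to the shifted sequence.
    have h0 : (1 - T) (z 0) = T ((-a) • z 1) := by
      have h := hz 0 (by omega)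
      rw [map_sub, zero_add] at h
      rw [LinearMap.sub_apply, Module.End.one_apply, neg_smul, map_neg]
      nth_rewrite 1 [← h]
      abel
    have hc : Commute ((1 - T) ^ m) T := ((Commute.one_left T).sub_left (Commute.refl T)).pow_left m
    have h1 : ((1 - T) ^ (m + 1)) (z 0) = T (((1 - T) ^ m) ((-a) • z 1)) := by
      rw [pow_succ, Module.End.mul_apply, h0, ← Module.End.mul_apply, hc.eq, Module.End.mul_apply]
    rw [h1]
    refine (hT _).trans ?_
    rw [map_smul, norm_smul, norm_neg, Real.norm_of_nonneg ha, pow_succ', mul_assoc]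
    gcongr
    exact ih (fun j => z (j + 1)) fun j hj => hz (j + 1) (by omega)

/-- The error `u - u_J` of the continuous algorithm is at most `a^{J+1} ‖Δ^{J+1} u‖`, where
`a = αδ²`. -/
lemma norm_sub_val_le {a : ℝ} (ha : 0 ≤ a) {J : ℕ} {u : L2 Ω d} {z : ℕ → L2 Ω d}
    (hz : IsLaplacianPowers u (J + 1) z) {U : ℕ → H10 Ω d} (h0 : IsResolvent a u (U 0))
    (hU : ∀ j, IsResolvent a (u - val (U j)) (U (j + 1) - U j)) :
    ‖u - val (U J)‖ ≤ a ^ (J + 1) * ‖z (J + 1)‖ := by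
  obtain ⟨T, hT, hTR⟩ := exists_linearMap_resolvent (Ω := Ω) (d := d) ha
  have hE : ∀ j, u - val (U j) = ((1 - T : Module.End ℝ (L2 Ω d)) ^ (j + 1)) u := fun j => by
    induction j with
    | zero => simp [hTR _ _ h0]
    | succ j ih =>
      rw [pow_succ', Module.End.mul_apply, ← ih, LinearMap.sub_apply, Module.End.one_apply,
        hTR _ _ (hU j), map_sub]
      abel
  obtain ⟨rfl, hz⟩ := hz
  rw [hE]
  refine norm_one_sub_pow_apply_le T hT ha (J + 1) z fun j hj => ?_
  obtain ⟨⟨v, hv⟩, hL⟩ := hz j hj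
  rw [← hv] at hL ⊢
  -- Since `z j` lies in H¹₀, Green's formula extends from test functions to all of H¹₀ and shows
  -- that `z j` solves the problem with datum `z j - a • z (j + 1)`.
  refine hTR _ _ fun x => ?_
  rw [hL.inner_grad_grad, inner_sub_left, real_inner_smul_left]
  ring

/-! ### The energy norm and stability of the error recursion. -/

/-- The map `p ↦ (√a ∇p, p)`, whose norm is the energy norm. -/
def energyMap (a : ℝ) : H10 Ω d →ₗ[ℝ] WithLp 2 ((PiLp 2 fun _ : Fin n => L2 Ω d) × L2 Ω d) :=
  (WithLp.linearEquiv 2 ℝ _).symm.toLinearMap ∘ₗ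
    (√a • (grad : H10 Ω d →L[ℝ] _).toLinearMap).prod (val : H10 Ω d →L[ℝ] _).toLinearMap

lemma inner_energyMap {a : ℝ} (ha : 0 ≤ a) (p q : H10 Ω d) :
    inner ℝ (energyMap a p) (energyMap a q) =
      a * inner ℝ (grad p) (grad q) + inner ℝ (val p) (val q) := by
  refine (WithLp.prod_inner_apply (𝕜 := ℝ) _ _).trans ?_
  change inner ℝ (√a • grad p) (√a • grad q) + inner ℝ (val p) (val q) = _
  rw [real_inner_smul_left, real_inner_smul_right, ← mul_assoc, Real.mul_self_sqrt ha]

lemma norm_energyMap_sq {a : ℝ} (ha : 0 ≤ a) (p : H10 Ω d) :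
    ‖energyMap a p‖ ^ 2 = a * ‖grad p‖ ^ 2 + ‖val p‖ ^ 2 := by
  simp only [← real_inner_self_eq_norm_sq, inner_energyMap ha]

lemma norm_val_le_norm_energyMap {a : ℝ} (ha : 0 ≤ a) (p : H10 Ω d) :
    ‖val p‖ ≤ ‖energyMap a p‖ := by
  refine le_of_sq_le_sq ?_ (norm_nonneg _)
  rw [norm_energyMap_sq ha]
  exact le_add_of_nonneg_left (by positivity)

lemma norm_energyMap_le {a : ℝ} (ha : 0 ≤ a) (p : H10 Ω d) :
    ‖energyMap a p‖ ≤ √a * ‖grad p‖ + ‖val p‖ := by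
  refine le_of_sq_le_sq ?_ (by positivity)
  rw [norm_energyMap_sq ha, add_sq, mul_pow, Real.sq_sqrt ha]
  have : 0 ≤ 2 * (√a * ‖grad p‖) * ‖val p‖ := by positivity
  linarith

/-- Constant one is essential: it keeps the previous error from being amplified. -/
lemma mul_inner_grad_grad_le {a : ℝ} (ha : 0 ≤ a) (p q : H10 Ω d) :
    a * inner ℝ (grad p) (grad q) ≤ ‖energyMap a p‖ * ‖energyMap a q‖ := by
  have h : ∀ p : H10 Ω d, √a * ‖grad p‖ ≤ ‖energyMap a p‖ := fun p => by
    refine le_of_sq_le_sq ?_ (norm_nonneg _)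
    rw [norm_energyMap_sq ha, mul_pow, Real.sq_sqrt ha]
    exact le_add_of_nonneg_right (by positivity)
  calc a * inner ℝ (grad p) (grad q) ≤ a * (‖grad p‖ * ‖grad q‖) := by
        gcongr; exact real_inner_le_norm _ _
    _ = (√a * ‖grad p‖) * (√a * ‖grad q‖) := by
        nth_rewrite 1 [← Real.mul_self_sqrt ha]; ring
    _ ≤ _ := by gcongr <;> exact h _

/-- The energy estimate for one step of the error recursion. -/
lemma norm_energyMap_error_le {a : ℝ} (ha : 0 ≤ a) {e e' η : H10 Ω d}
    (h : a * inner ℝ (grad e) (grad (e - η)) + inner ℝ (val e) (val (e - η)) =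
      a * inner ℝ (grad e') (grad (e - η))) :
    ‖energyMap a e‖ ≤ ‖energyMap a e'‖ + 2 * ‖energyMap a η‖ := by
  set φ := e - η with hφ
  have he : energyMap a e = energyMap a φ + energyMap a η := by rw [← map_add, hφ, sub_add_cancel]
  -- In the energy inner product, ‖φ‖² = a(∇e', ∇φ) - ⟨η, φ⟩. The second copy of ‖η‖ in the result
  -- comes from e = φ + η.
  have h1 : ‖energyMap a φ‖ ^ 2 ≤ (‖energyMap a e'‖ + ‖energyMap a η‖) * ‖energyMap a φ‖ := by
    have h2 := mul_inner_grad_grad_le ha e' φ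
    rw [← h, ← inner_energyMap ha, he, inner_add_left, real_inner_self_eq_norm_sq] at h2
    have h3 := neg_le_of_abs_le (abs_real_inner_le_norm (energyMap a η) (energyMap a φ))
    linarith
  have h4 : ‖energyMap a φ‖ ≤ ‖energyMap a e'‖ + ‖energyMap a η‖ := by
    by_contra! hlt
    nlinarith [norm_nonneg (energyMap a e'), norm_nonneg (energyMap a η)]
  have h5 := norm_add_le (energyMap a φ) (energyMap a η)
  rw [← he] at h5
  linarith

/-! ### Discrete iterates and their distance to the continuous ones. -/

/-- The discrete problems are solvable for `a ≥ 0`. -/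
lemma exists_isGalerkinSol (V : Submodule ℝ (H10 Ω d)) [FiniteDimensional ℝ V] {a : ℝ}
    (ha : 0 ≤ a) (f : L2 Ω d) (g : H10 Ω d) :
    ∃ w, IsGalerkinSol V a (fun v => inner ℝ f (val v) + a * inner ℝ (grad g) (grad v)) w := by
  rcases ha.eq_or_lt with rfl | ha'
  -- Coercivity in H¹ fails for `a = 0`; the solution is then the L² projection of `f` onto the
  -- image of `V`.
  · let W : Submodule ℝ (L2 Ω d) := V.map (val : H10 Ω d →L[ℝ] L2 Ω d).toLinearMap
    obtain ⟨w, hw, hwf⟩ := (W.starProjection_apply_mem f : W.starProjection f ∈ W)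
    refine ⟨w, hw, fun v hv => ?_⟩
    have h := W.starProjection_inner_eq_zero f (val v) ⟨v, hv, rfl⟩
    rw [← hwf, inner_sub_left, sub_eq_zero] at h
    simp only [zero_mul, zero_add, add_zero]
    exact h.symm
  · have : CompleteSpace V := FiniteDimensional.complete ℝ V
    exact (existsUnique_isGalerkinSol V ha'
      ((innerSL ℝ f) ∘L val + a • ((innerSL ℝ (grad g)) ∘L grad))).exists

lemma isGalerkinSol_discFilter (V : Submodule ℝ (H10 Ω d)) [FiniteDimensional ℝ V] (δ : ℝ)
    (f : L2 Ω d) :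
    IsGalerkinSol V (δ ^ 2) (fun v => inner ℝ f (val v)) (discFilter V δ f) := by
  refine Classical.epsilon_spec ?_
  simpa using exists_isGalerkinSol V (sq_nonneg δ) f 0

lemma IsGalerkinSol.congr {V : Submodule ℝ (H10 Ω d)} {a : ℝ} {ℓ ℓ' : H10 Ω d → ℝ} {w : H10 Ω d}
    (h : IsGalerkinSol V a ℓ w) (hℓ : ∀ v ∈ V, ℓ v = ℓ' v) : IsGalerkinSol V a ℓ' w :=
  ⟨h.1, fun v hv => (h.2 v hv).trans (hℓ v hv)⟩

/-- For data G^h f, the defining equation of G^h turns the right-hand side into (f, v). -/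
lemma isGalerkinSol_discMitlar_zero (V : Submodule ℝ (H10 Ω d)) [FiniteDimensional ℝ V] {α : ℝ}
    (hα : 0 ≤ α) (δ : ℝ) (f : L2 Ω d) :
    IsGalerkinSol V (α * δ ^ 2) (fun v => inner ℝ f (val v))
      (discMitlar V α δ (discFilter V δ f) 0) := by
  have hF := (isGalerkinSol_discFilter V δ f).2
  obtain ⟨w, hw⟩ := exists_isGalerkinSol V (mul_nonneg hα (sq_nonneg δ)) f 0
  refine IsGalerkinSol.congr (Classical.epsilon_spec
    ⟨w, hw.congr (ℓ' := fun v => δ ^ 2 * inner ℝ (grad (discFilter V δ f)) (grad v) +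
      inner ℝ (val (discFilter V δ f)) (val v)) fun v hv => ?_⟩) hF
  simp [hF v hv]

lemma isGalerkinSol_discMitlar_succ (V : Submodule ℝ (H10 Ω d)) [FiniteDimensional ℝ V] {α : ℝ}
    (hα : 0 ≤ α) (δ : ℝ) (f : L2 Ω d) (j : ℕ) :
    IsGalerkinSol V (α * δ ^ 2) (fun v => inner ℝ f (val v) +
        α * δ ^ 2 * inner ℝ (grad (discMitlar V α δ (discFilter V δ f) j)) (grad v))
      (discMitlar V α δ (discFilter V δ f) (j + 1)) := by
  have hF := (isGalerkinSol_discFilter V δ f).2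
  obtain ⟨w, hw⟩ := exists_isGalerkinSol V (mul_nonneg hα (sq_nonneg δ)) f
    (discMitlar V α δ (discFilter V δ f) j)
  refine IsGalerkinSol.congr (Classical.epsilon_spec
    ⟨w, hw.congr (ℓ' := fun v => δ ^ 2 * inner ℝ (grad (discFilter V δ f)) (grad v) +
      inner ℝ (val (discFilter V δ f)) (val v) +
      α * δ ^ 2 * inner ℝ (grad (discMitlar V α δ (discFilter V δ f) j)) (grad v))
      fun v hv => ?_⟩) fun v hv => ?_
  all_goals simp only [hF v hv]

/-- The distance in the energy norm between the continuous and the discrete iterates, in terms of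
the approximation errors `η j = U j - v j`, `v j ∈ X^h`, of the continuous iterates. -/
lemma norm_energyMap_sub_discMitlar_le (V : Submodule ℝ (H10 Ω d)) [FiniteDimensional ℝ V]
    {α δ : ℝ} (hα : 0 ≤ α) {u : L2 Ω d} {U : ℕ → H10 Ω d}
    (h0 : IsResolvent (α * δ ^ 2) u (U 0))
    (hU : ∀ j, IsResolvent (α * δ ^ 2) (u - val (U j)) (U (j + 1) - U j)) {J : ℕ} {ε : ℝ}
    (hε : ∀ j ≤ J, ∃ v ∈ V, ‖energyMap (α * δ ^ 2) (U j - v)‖ ≤ ε) :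
    ‖energyMap (α * δ ^ 2) (U J - discMitlar V α δ (discFilter V δ u) J)‖ ≤
      2 * (J + 1) * ε := by
  have ha : 0 ≤ α * δ ^ 2 := mul_nonneg hα (sq_nonneg δ)
  induction J with
  | zero =>
    obtain ⟨v, hv, hvε⟩ := hε 0 le_rfl
    obtain ⟨hD, hDs⟩ := isGalerkinSol_discMitlar_zero V hα δ u
    set D := discMitlar V α δ (discFilter V δ u) 0
    have h := norm_energyMap_error_le ha (e := U 0 - D) (e' := 0) (η := U 0 - v) (by
      -- The difference is v - D, hence an admissible discrete test function. The recursion starts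
      -- with zero previous error.
      have hφ : U 0 - D - (U 0 - v) ∈ V := by
        rw [sub_sub_sub_cancel_left]
        exact V.sub_mem hv hD
      generalize U 0 - D - (U 0 - v) = φ at hφ ⊢
      have h1 := h0 φ
      have h2 := hDs φ hφ
      simp only [map_sub, map_zero, inner_sub_left, inner_zero_left]
      linarith)
    rw [map_zero, norm_zero] at h
    push_cast
    linarith
  | succ J ih =>
    obtain ⟨v, hv, hvε⟩ := hε (J + 1) le_rfl
    obtain ⟨hD, hDs⟩ := isGalerkinSol_discMitlar_succ V hα δ u J
    have ih := ih fun j hj => hε j (by omega)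
    set D := discMitlar V α δ (discFilter V δ u) (J + 1)
    set D' := discMitlar V α δ (discFilter V δ u) J
    have h := norm_energyMap_error_le ha (e := U (J + 1) - D) (e' := U J - D')
      (η := U (J + 1) - v) (by
      have hφ : U (J + 1) - D - (U (J + 1) - v) ∈ V := by
        rw [sub_sub_sub_cancel_left]
        exact V.sub_mem hv hD
      generalize U (J + 1) - D - (U (J + 1) - v) = φ at hφ ⊢
      -- Rearranged, this is a(∇U_{J+1}, ∇φ) + (U_{J+1}, φ) = (u, φ) + a(∇U_J, ∇φ), the same form as
      -- the discrete equation `h2`.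
      have h1 := hU J φ
      have h2 := hDs φ hφ
      simp only [map_sub, inner_sub_left] at h1 ⊢
      linarith)
    push_cast
    linarith

lemma norm_grad_le (p : H10 Ω d) : ‖grad p‖ ≤ ‖p‖ :=
  WithLp.norm_snd_le _ _

/-- The weight √(αδ²) = √α δ multiplies the H¹ rate h^k, and the L² part contributes h^{k+1}. The
sign of `A` is not assumed, hence `|A|`. -/
lemma HasApproxProperty.exists_norm_energyMap_le {V : Submodule ℝ (H10 Ω d)} {k : ℕ} {h A : ℝ}
    (hV : HasApproxProperty V k h A) (hh : 0 < h) {α δ : ℝ} (hα : 0 ≤ α) (hδ : 0 < δ)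
    {w : H10 Ω d} {M : ℝ≥0∞} (hM : M ≠ ∞) (hw : sobolevENorm Ω (k + 1) (val w) ≤ M) :
    ∃ v ∈ V, ‖energyMap (α * δ ^ 2) (w - v)‖ ≤
      |A| * (√α * δ * h ^ k + h ^ (k + 1)) * M.toReal := by
  obtain ⟨v, hv, h1, h2⟩ := hV w (ne_top_of_le_ne_top hM hw)
  refine ⟨v, hv, (norm_energyMap_le (by positivity) _).trans ?_⟩
  have hs : √(α * δ ^ 2) = √α * δ := by rw [Real.sqrt_mul hα, Real.sqrt_sq hδ.le]
  have hm := ENNReal.toReal_mono hM hw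
  have hA : ∀ m : ℕ, A * h ^ m * (sobolevENorm Ω (k + 1) (val w)).toReal ≤
      |A| * h ^ m * M.toReal := fun m => by
    gcongr
    exact le_abs_self A
  calc √(α * δ ^ 2) * ‖grad (w - v)‖ + ‖val (w - v)‖
      ≤ √α * δ * (|A| * h ^ k * M.toReal) + |A| * h ^ (k + 1) * M.toReal := by
        rw [hs]
        gcongr
        · exact (norm_grad_le _).trans (h2.trans (hA _))
        · exact h1.trans (hA _)
    _ = _ := by ring

end Mitlar

end

theorem mainTheorem3 (J : ℕ) (A : ℝ) :
    ∃ C : ℝ, 0 < C ∧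
      ∀ (n d k : ℕ) (Ω : TopologicalSpace.Opens (EuclideanSpace ℝ (Fin n)))
        (h : ℝ) (_ : 0 < h)
        (Xh : Submodule ℝ (Mitlar.H10 Ω d)) (_ : FiniteDimensional ℝ Xh)
        (_ : Mitlar.HasApproxProperty Xh k h A)
        (δ α : ℝ) (_ : 0 < δ) (_ : 0 ≤ α) (_ : α ≤ 1)
        (u : Mitlar.L2 Ω d) (z : ℕ → Mitlar.L2 Ω d) (_ : Mitlar.IsLaplacianPowers u (J + 1) z),
        ‖u - Mitlar.val (Mitlar.discMitlar Xh α δ (Mitlar.discFilter Xh δ u) J)‖ₑ ≤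
          ENNReal.ofReal ((α * δ ^ 2) ^ (J + 1) * ‖z (J + 1)‖) +
            ENNReal.ofReal (C * (√α * δ * h ^ k + h ^ (k + 1))) *
              (Finset.range (J + 1)).sup fun j =>
                Mitlar.sobolevENorm Ω (k + 1)
                  (Mitlar.mitlar α δ (Mitlar.val (Mitlar.diffFilter δ u)) j) := by
  -- The factor 2(J + 1) comes from the error recursion. The extra 1 keeps the coefficient positive
  -- even if `A = 0`, so that an infinite Sobolev norm makes the right-hand side infinite.
  refine ⟨2 * (J + 1) * |A| + 1, by positivity, ?_⟩
  intro n d k Ω h hh Xh _ hX δ α hδ hα _ u z hz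
  set M : ℝ≥0∞ := (Finset.range (J + 1)).sup fun j =>
    Mitlar.sobolevENorm Ω (k + 1) (Mitlar.mitlar α δ (Mitlar.val (Mitlar.diffFilter δ u)) j)
  have hpos : 0 < (2 * (J + 1) * |A| + 1) * (√α * δ * h ^ k + h ^ (k + 1)) := by positivity
  rcases eq_or_ne M ∞ with htop | htop
  · rw [htop, ENNReal.mul_top (ENNReal.ofReal_pos.2 hpos).ne', add_top]
    exact le_top
  have ha : 0 ≤ α * δ ^ 2 := by positivity
  obtain ⟨w, hw⟩ := (hz.2 0 (by omega)).1
  rw [hz.1] at hw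
  obtain ⟨U, hUm, hU0, hU⟩ := Mitlar.exists_mitlar_eq_val hα hδ w
  simp only [hw] at hUm hU0 hU
  have hcont := Mitlar.norm_sub_val_le ha hz hU0 hU
  have hdisc := Mitlar.norm_energyMap_sub_discMitlar_le Xh hα hU0 hU (J := J) fun j hj =>
    hX.exists_norm_energyMap_le hh hα hδ htop (by
      rw [← hUm j]
      exact Finset.le_sup (f := fun j => Mitlar.sobolevENorm Ω (k + 1)
        (Mitlar.mitlar α δ (Mitlar.val (Mitlar.diffFilter δ u)) j)) (by simp; omega))
  have hval := (Mitlar.norm_val_le_norm_energyMap ha _).trans hdisc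
  set D := Mitlar.discMitlar Xh α δ (Mitlar.discFilter Xh δ u) J
  have hreal : ‖u - Mitlar.val D‖ ≤ (α * δ ^ 2) ^ (J + 1) * ‖z (J + 1)‖ +
      (2 * (J + 1) * |A| + 1) * (√α * δ * h ^ k + h ^ (k + 1)) * M.toReal := by
    have htri := norm_sub_le_norm_sub_add_norm_sub u (Mitlar.val (U J)) (Mitlar.val D)
    rw [map_sub] at hval
    have : 0 ≤ (√α * δ * h ^ k + h ^ (k + 1)) * M.toReal := by positivity
    linarith
  rw [← ENNReal.ofReal_toReal htop, ← ENNReal.ofReal_mul hpos.le,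
    ← ENNReal.ofReal_add (by positivity) (by positivity), ← ofReal_norm]
  exact ENNReal.ofReal_le_ofReal hreal
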